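/- Let $\mathbf{K}$ be a cocomplete category (all small colimits exist, Hom-sets are small), and let $\mathbf{Pro}(\mathbf{K})$ be its pro-category, i.e. the opposite of the full subcategory of $\mathbf{Set}^{\mathbf{K}}$ formed by the small filtered colimits of representable functors $\mathrm{Hom}_{\mathbf{K}}(Y,-)$. The category $\mathbf{K}$ is viewed as a full subcategory of $\mathbf{Pro}(\mathbf{K})$ via $Y\mapsto \mathrm{Hom}_{\mathbf{K}}(Y,-)$; a pro-object is called rudimentary if it is isomorphic to an object of $\mathbf{K}$. Let $X$ be a topological space and let $\mathbf{L}$ be $\mathbf{K}$ or $\mathbf{Pro}(\mathbf{K})$. An $\mathbf{L}$-valued precosheaf on $X$ is a covariant functor from the poset of open subsets of $X$ to $\mathbf{L}$. It is coseparated (respectively, a cosheaf) if for every open $U\subseteq X$ and every covering sieve $R$ on $U$ (a family $R$ of open subsets of $U$, closed under passing to smaller open subsets, with union $U$) the canonical morphism $\varinjlim_{V\in R}\mathcal{A}(V)\to\mathcal{A}(U)$, with the colimit taken in $\mathbf{L}$, is an epimorphism (respectively, an isomorphism). A morphism $\mathcal{A}\to\mathcal{B}$ of $\mathbf{K}$-valued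 precosheaves is a strong local isomorphism if for every $x\in X$ the induced morphism $\varprojlim_{U\ni x}\mathcal{A}(U)\to\varprojlim_{U\ni x}\mathcal{B}(U)$, with the limits over the open neighbourhoods of $x$ taken in $\mathbf{Pro}(\mathbf{K})$, is an isomorphism. A $\mathbf{K}$-valued precosheaf $\mathcal{A}$ is smooth if there are a $\mathbf{K}$-valued precosheaf $\mathcal{B}$, a $\mathbf{K}$-valued cosheaf $\mathcal{C}$ and strong local isomorphisms $\mathcal{A}\to\mathcal{B}\leftarrow\mathcal{C}$. Let $\mathcal{A}$ be a $\mathbf{K}$-valued precosheaf on $X$. Then: 1. $\mathcal{A}$ is coseparated if and only if it is coseparated as a $\mathbf{Pro}(\mathbf{K})$-valued precosheaf, and $\mathcal{A}$ is a cosheaf if and only if it is a cosheaf as a $\mathbf{Pro}(\mathbf{K})$-valued precosheaf. 2. The cosheafification $\mathcal{A}_{\#}\to\mathcal{A}$ of $\mathcal{A}$ in $\mathbf{Pro}(\mathbf{K})$-valued precosheaves exists, i.e. $\mathcal{A}_{\#}$ is a $\mathbf{Pro}(\mathbf{K})$-valued cosheaf and every morphism $\mathcal{D}\to\mathcal{A}$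 from a $\mathbf{Pro}(\mathbf{K})$-valued cosheaf $\mathcal{D}$ factors uniquely through $\mathcal{A}_{\#}\to\mathcal{A}$. The precosheaf $\mathcal{A}$ is smooth if and only if $\mathcal{A}_{\#}(U)$ is rudimentary for every open subset $U\subseteq X$. The same equivalence holds when smoothness is replaced by the existence of a $\mathbf{K}$-valued precosheaf $\mathcal{B}'$, a $\mathbf{K}$-valued cosheaf $\mathcal{C}$ and strong local isomorphisms $\mathcal{A}\leftarrow\mathcal{B}'\to\mathcal{C}$. -/

import Mathlib

open CategoryTheory CategoryTheory.Limits TopologicalSpace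

universe v u w

namespace ProCosheaf

section ProCategory

variable (K : Type u) [Category.{v} K]

/-- The pro-category `Pro(K)`, as the opposite of the category of ind-objects of `Kᵒᵖ`. Its objects
are the set-valued functors on `K = (Kᵒᵖ)ᵒᵖ` that are small filtered colimits of functors
`Hom(X, -)`, and its morphisms are natural transformations in the opposite direction. -/
abbrev Pro : Type (max u (v + 1)) := (Ind Kᵒᵖ)ᵒᵖ

/-- The full embedding `K ⥤ Pro(K)` sending an object `X` to the rudimentary pro-object given by
the one-object diagram `X`, that is, by the functor `Hom(X, -)`. -/
noncomputable abbrev toPro : K ⥤ Pro K := opOp K ⋙ (Ind.yoneda (C := Kᵒᵖ)).op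

end ProCategory

variable {K : Type u} [Category.{v} K]

/-- A pro-object is rudimentary if it is isomorphic to (the image of) an object of `K`. -/
def IsRudimentary (P : Pro K) : Prop := (toPro K).essImage P

section Cosheaves

variable {X : TopCat.{v}} {L : Type w} [Category.{v} L]

/-- For a sieve `R` on the open set `U`, the canonical morphism
`colim_{(V ⊆ U) ∈ R} A(V) ⟶ A(U)`. -/
noncomputable def sieveMap [HasColimits L] (A : Opens X ⥤ L) {U : Opens X} (R : Sieve U) :
    colimit (R.arrows.diagram ⋙ A) ⟶ A.obj U :=
  colimit.desc (R.arrows.diagram ⋙ A) (A.mapCocone R.arrows.cocone)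

/-- A precosheaf is coseparated if `colim_{(V ⊆ U) ∈ R} A(V) ⟶ A(U)` is an epimorphism for every
open set `U` and every covering sieve `R` on `U`. -/
def IsCoseparated [HasColimits L] (A : Opens X ⥤ L) : Prop :=
  ∀ (U : Opens X) (R : Sieve U), R ∈ Opens.grothendieckTopology X U → Epi (sieveMap A R)

/-- A precosheaf is a cosheaf if `colim_{(V ⊆ U) ∈ R} A(V) ⟶ A(U)` is an isomorphism for every
open set `U` and every covering sieve `R` on `U`. -/
def IsCosheaf [HasColimits L] (A : Opens X ⥤ L) : Prop :=
  ∀ (U : Opens X) (R : Sieve U), R ∈ Opens.grothendieckTopology X U → IsIso (sieveMap A R)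

/-- `ε : C ⟶ A` exhibits `C` as the cosheafification of `A`: it is the coreflection of the
precosheaf `A` into the full subcategory of cosheaves. -/
structure IsCosheafification [HasColimits L] {C A : Opens X ⥤ L} (ε : C ⟶ A) : Prop where
  isCosheaf : IsCosheaf C
  existsUnique_lift : ∀ (D : Opens X ⥤ L), IsCosheaf D → ∀ φ : D ⟶ A, ∃! ψ : D ⟶ C, ψ ≫ ε = φ

/-- The costalk of a precosheaf at `x`: the limit of `A(U)` over the open neighbourhoods `U`
of `x`. -/
noncomputable def costalk [HasCofilteredLimitsOfSize.{v, v} L] (A : Opens X ⥤ L) (x : X) : L :=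
  limit (OpenNhds.inclusion x ⋙ A)

/-- The morphism of costalks at `x` induced by a morphism of precosheaves. -/
noncomputable def costalkMap [HasCofilteredLimitsOfSize.{v, v} L] {A B : Opens X ⥤ L} (f : A ⟶ B)
    (x : X) : costalk A x ⟶ costalk B x :=
  limMap (Functor.whiskerLeft (OpenNhds.inclusion x) f)

end Cosheaves

variable {X : TopCat.{v}}

/-- A morphism of `K`-valued precosheaves is a strong local isomorphism (a local isomorphism in the
sense of Bredon) if it induces isomorphisms on all costalks taken in `Pro(K)`. -/
def IsStrongLocalIso {A B : Opens X ⥤ K} (f : A ⟶ B) : Prop :=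
  ∀ x : X, IsIso (costalkMap (Functor.whiskerRight f (toPro K)) x)

/-- A `K`-valued precosheaf `A` is smooth if there are strong local isomorphisms `A ⟶ B ⟵ C` of
`K`-valued precosheaves with `C` a cosheaf. -/
def IsSmooth [HasColimits K] (A : Opens X ⥤ K) : Prop :=
  ∃ (B C : Opens X ⥤ K) (f : A ⟶ B) (g : C ⟶ B),
    IsCosheaf C ∧ IsStrongLocalIso f ∧ IsStrongLocalIso g

/-- The other form of smoothness: there are strong local isomorphisms `A ⟵ B' ⟶ C` of `K`-valued
precosheaves with `C` a cosheaf. -/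
def IsSmooth' [HasColimits K] (A : Opens X ⥤ K) : Prop :=
  ∃ (B' C : Opens X ⥤ K) (f : B' ⟶ A) (g : B' ⟶ C),
    IsCosheaf C ∧ IsStrongLocalIso f ∧ IsStrongLocalIso g

end ProCosheaf

/-! Dualise: a `Pro K`-valued precosheaf is a presheaf with values in `Ind Kᵒᵖ`, and cosheaves
become sheaves. As `Kᵒᵖ` is complete, the evaluations `indEval c` into sets preserve limits and
filtered colimits and jointly detect isomorphisms, so sheafification and stalks can be tested on
presheaves of sets. Strong local isomorphisms are then the maps inverted by sheafification
(`isStrongLocalIso_iff`, `isIso_sheafifyMap`), so a smooth `A` has the same cosheafification as a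
`K`-valued cosheaf. Conversely, a cosheafification with rudimentary values descends to `K`, and its
counit is a strong local isomorphism. The claims on `K` versus `Pro K` hold because the embedding is
fully faithful and preserves colimits. -/

namespace ProCosheaf

open Opposite

/-! ### Evaluation of ind-objects -/

section Ind

variable {C : Type u} [Category.{v} C]

/-- Evaluation of ind-objects, seen as presheaves, at an object. -/
noncomputable def indEval (c : Cᵒᵖ) : Ind C ⥤ Type v :=
  Ind.inclusion C ⋙ (evaluation Cᵒᵖ (Type v)).obj c

instance (c : Cᵒᵖ) {J : Type v} [SmallCategory J] [IsFiltered J] :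
    PreservesColimitsOfShape J (indEval c) :=
  inferInstanceAs (PreservesColimitsOfShape J (Ind.inclusion C ⋙ (evaluation _ _).obj c))

instance [HasLimits C] (c : Cᵒᵖ) : PreservesLimits (indEval c) :=
  inferInstanceAs (PreservesLimits (Ind.inclusion C ⋙ (evaluation _ _).obj c))

theorem isIso_iff_indEval {P Q : Ind C} (f : P ⟶ Q) :
    IsIso f ↔ ∀ c, IsIso ((indEval c).map f) := by
  refine ⟨fun _ _ => inferInstance, fun h => ?_⟩
  have : ∀ c, IsIso (((Ind.inclusion C).map f).app c) := h
  have := NatIso.isIso_of_isIso_app ((Ind.inclusion C).map f)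
  exact isIso_of_reflects_iso f (Ind.inclusion C)

theorem isIso_iff_whiskerRight_indEval {D : Type w} [Category D] {P Q : D ⥤ Ind C} (f : P ⟶ Q) :
    IsIso f ↔ ∀ c, IsIso (Functor.whiskerRight f (indEval c)) := by
  simp only [NatTrans.isIso_iff_isIso_app, isIso_iff_indEval, Functor.whiskerRight_app]
  exact forall_comm

end Ind

/-! ### Local isomorphisms and sheafification of presheaves of ind-objects -/

section LocalIso

variable {X : TopCat.{v}}

theorem isIso_iff_of_commSq {D : Type w} [Category D] {P Q P' Q' : D} {f : P ⟶ Q} {a : P ⟶ P'}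
    {b : Q ⟶ Q'} {g : P' ⟶ Q'} [IsIso a] [IsIso b] (h : CommSq f a b g) : IsIso g ↔ IsIso f := by
  rw [← isIso_comp_right_iff f b, h.w, isIso_comp_left_iff]

/-- Isomorphisms of sheaves are detected on stalks, and the sheafification unit is bijective on
stalks. -/
theorem W_iff_stalk {P Q : TopCat.Presheaf (Type v) X} (f : P ⟶ Q) :
    (Opens.grothendieckTopology X).W f ↔
      ∀ x, IsIso ((TopCat.Presheaf.stalkFunctor (Type v) x).map f) := by
  rw [GrothendieckTopology.W_iff]
  refine (TopCat.Presheaf.isIso_iff_stalkFunctor_map_iso _).trans (forall_congr' fun x => ?_)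
  have := TopCat.Presheaf.stalkFunctor_map_unit_toSheafify_isIso x (Type v) P
  have := TopCat.Presheaf.stalkFunctor_map_unit_toSheafify_isIso x (Type v) Q
  refine isIso_iff_of_commSq (a := (TopCat.Presheaf.stalkFunctor (Type v) x).map
    (toSheafify (Opens.grothendieckTopology X) P))
    (b := (TopCat.Presheaf.stalkFunctor (Type v) x).map
      (toSheafify (Opens.grothendieckTopology X) Q)) ⟨?_⟩
  rw [← Functor.map_comp, ← Functor.map_comp]
  exact congrArg _ ((sheafificationAdjunction
    (Opens.grothendieckTopology X) (Type v)).unit.naturality f)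

variable {C : Type u} [Category.{v} C]

/-- A morphism of presheaves of ind-objects is a local isomorphism if it becomes an isomorphism
after evaluating at every object and sheafifying. -/
def IsLocalIso {P Q : (Opens X)ᵒᵖ ⥤ Ind C} (f : P ⟶ Q) : Prop :=
  ∀ c, (Opens.grothendieckTopology X).W (Functor.whiskerRight f (indEval c))

theorem isLocalIso_of_isIso {P Q : (Opens X)ᵒᵖ ⥤ Ind C} (f : P ⟶ Q) [IsIso f] :
    IsLocalIso f :=
  fun _ => MorphismProperty.of_isIso _ _

theorem isLocalIso_comp {P Q R : (Opens X)ᵒᵖ ⥤ Ind C} {f : P ⟶ Q} {g : Q ⟶ R}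
    (hf : IsLocalIso f) (hg : IsLocalIso g) : IsLocalIso (f ≫ g) := fun c => by
  rw [Functor.whiskerRight_comp]
  exact MorphismProperty.comp_mem _ _ _ (hf c) (hg c)

theorem isLocalIso_of_precomp {P Q R : (Opens X)ᵒᵖ ⥤ Ind C} {f : P ⟶ Q} {g : Q ⟶ R}
    (hf : IsLocalIso f) (hfg : IsLocalIso (f ≫ g)) : IsLocalIso g := fun c => by
  refine MorphismProperty.of_precomp _ _ _ (hf c) ?_
  rw [← Functor.whiskerRight_comp]
  exact hfg c

theorem isSheaf_iff_indEval [HasLimits C] (P : (Opens X)ᵒᵖ ⥤ Ind C) :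
    Presheaf.IsSheaf (Opens.grothendieckTopology X) P ↔
      ∀ c, Presheaf.IsSheaf (Opens.grothendieckTopology X) (P ⋙ indEval c) := by
  refine ⟨fun h c => Presheaf.isSheaf_comp_of_isSheaf _ _ _ h, fun h => ?_⟩
  refine Presheaf.isSheaf_of_isSheaf_comp _ _ (Ind.inclusion C) ?_
  simp only [Presheaf.isSheaf_iff_isLimit] at h ⊢
  exact fun U S hS => ⟨evaluationJointlyReflectsLimits _ fun c => (h c S hS).some⟩

/-- Stalks are filtered colimits, so they commute with every `indEval c`. -/
theorem isLocalIso_iff_stalk {P Q : (Opens X)ᵒᵖ ⥤ Ind C} (f : P ⟶ Q) :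
    IsLocalIso f ↔ ∀ x : X,
      IsIso (colimMap (Functor.whiskerLeft (OpenNhds.inclusion x).op f)) := by
  simp only [IsLocalIso, W_iff_stalk]
  rw [forall_comm]
  refine forall_congr' fun x => ?_
  rw [isIso_iff_indEval]
  refine forall_congr' fun c => ?_
  exact (NatIso.isIso_map_iff (preservesColimitNatIso (J := (OpenNhds x)ᵒᵖ) (indEval c))
    (Functor.whiskerLeft (OpenNhds.inclusion x).op f)).symm

variable [HasLimits C]

theorem isSheaf_sheafify (P : (Opens X)ᵒᵖ ⥤ Ind C) :
    Presheaf.IsSheaf (Opens.grothendieckTopology X)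
      ((Opens.grothendieckTopology X).sheafify P) := by
  rw [isSheaf_iff_indEval]
  intro c
  exact (Presheaf.isSheaf_of_iso_iff
    ((Opens.grothendieckTopology X).sheafifyCompIso (indEval c) P)).2
    (GrothendieckTopology.sheafify_isSheaf _ _)

/-- The plus construction uses only limits and filtered colimits, so evaluation carries this unit to
the set-valued one. -/
theorem isLocalIso_toSheafify (P : (Opens X)ᵒᵖ ⥤ Ind C) :
    IsLocalIso ((Opens.grothendieckTopology X).toSheafify P) := by
  intro c
  rw [← (Opens.grothendieckTopology X).toSheafify_comp_sheafifyCompIso_inv (indEval c) P]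
  exact MorphismProperty.comp_mem _ _ _
    (GrothendieckTopology.W_adj_unit_app _
      (plusPlusAdjunction (Opens.grothendieckTopology X) (Type v)) (P ⋙ indEval c))
    (MorphismProperty.of_isIso _ _)

theorem isIso_of_isLocalIso {P Q : (Opens X)ᵒᵖ ⥤ Ind C}
    (hP : Presheaf.IsSheaf (Opens.grothendieckTopology X) P)
    (hQ : Presheaf.IsSheaf (Opens.grothendieckTopology X) Q) (f : P ⟶ Q) (hf : IsLocalIso f) :
    IsIso f := by
  rw [isIso_iff_whiskerRight_indEval]
  intro c
  let g : (⟨_, (isSheaf_iff_indEval P).1 hP c⟩ : Sheaf (Opens.grothendieckTopology X) (Type v)) ⟶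
    ⟨_, (isSheaf_iff_indEval Q).1 hQ c⟩ := ⟨Functor.whiskerRight f (indEval c)⟩
  have : IsIso g := (GrothendieckTopology.W_sheafToPresheaf_map_iff_isIso _ g).1 (hf c)
  exact inferInstanceAs (IsIso ((sheafToPresheaf _ _).map g))

theorem isIso_sheafifyMap {P Q : (Opens X)ᵒᵖ ⥤ Ind C} {f : P ⟶ Q} (hf : IsLocalIso f) :
    IsIso ((Opens.grothendieckTopology X).sheafifyMap f) := by
  refine isIso_of_isLocalIso (isSheaf_sheafify P) (isSheaf_sheafify Q) _ ?_
  refine isLocalIso_of_precomp (isLocalIso_toSheafify P) ?_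
  rw [← GrothendieckTopology.toSheafify_naturality]
  exact isLocalIso_comp hf (isLocalIso_toSheafify Q)

end LocalIso

/-! ### Passage from cosheaves to sheaves -/

section Dual

variable {D : Type w} [Category D]

theorem isIso_limMap_iff_isIso_colimMap_leftOp {J : Type v} [SmallCategory J] {F G : J ⥤ Dᵒᵖ}
    [HasLimit F] [HasLimit G] (α : F ⟶ G) :
    IsIso (limMap α) ↔ IsIso (colimMap (NatTrans.leftOp α)) := by
  rw [← isIso_unop_iff]
  refine isIso_iff_of_commSq (a := (colimitLeftOpIsoUnopLimit G).hom)
    (b := (colimitLeftOpIsoUnopLimit F).hom) ⟨?_⟩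
  refine colimit.hom_ext fun j => ?_
  rw [ι_colimMap_assoc, ι_comp_colimitLeftOpIsoUnopLimit_hom,
    ι_comp_colimitLeftOpIsoUnopLimit_hom_assoc, NatTrans.leftOp_app, ← unop_comp, ← unop_comp,
    limMap_π]

variable {X : TopCat.{v}}

theorem isIso_sieveMap_iff {L : Type w} [Category.{v} L] [HasColimits L] (A : Opens X ⥤ L)
    {U : Opens X} (R : Sieve U) :
    IsIso (sieveMap A R) ↔ Nonempty (IsColimit (A.mapCocone R.arrows.cocone)) :=
  ⟨fun h => ⟨(IsColimit.ofPointIso (colimit.isColimit _) (t := A.mapCocone R.arrows.cocone)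
    (i := h))⟩, fun ⟨h⟩ =>
    ((colimit.isColimit _).coconePointUniqueUpToIso h).isIso_hom⟩

theorem isCosheaf_iff_isSheaf_leftOp {D : Type w} [Category.{v} D] [HasColimits Dᵒᵖ]
    (A : Opens X ⥤ Dᵒᵖ) :
    IsCosheaf A ↔ Presheaf.IsSheaf (Opens.grothendieckTopology X) A.leftOp := by
  simp only [IsCosheaf, Presheaf.isSheaf_iff_isLimit, isIso_sieveMap_iff]
  refine forall_congr' fun U => forall_congr' fun R => forall_congr' fun hR => ?_
  exact ⟨fun ⟨h⟩ => ⟨isLimitConeLeftOpOfCocone _ h⟩,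
    fun ⟨h⟩ => ⟨isColimitOfConeLeftOpOfCocone _ h⟩⟩

end Dual

/-! ### Cosheafification and smoothness -/

variable {K : Type u} [Category.{v} K] {X : TopCat.{v}}

theorem isStrongLocalIso_iff {A B : Opens X ⥤ K} (f : A ⟶ B) :
    IsStrongLocalIso f ↔ IsLocalIso (NatTrans.leftOp (Functor.whiskerRight f (toPro K))) := by
  rw [isLocalIso_iff_stalk]
  exact forall_congr' fun x => isIso_limMap_iff_isIso_colimMap_leftOp _

theorem isStrongLocalIso_id (A : Opens X ⥤ K) : IsStrongLocalIso (𝟙 A) := by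
  rw [isStrongLocalIso_iff]
  have h : Functor.whiskerRight (𝟙 A) (toPro K) = 𝟙 _ := Functor.whiskerRight_id' _
  rw [h, NatTrans.leftOp_id]
  exact isLocalIso_of_isIso _

variable [HasColimits K]

instance preservesColimits_toPro : PreservesColimits (toPro K) := by
  have : PreservesColimitsOfSize.{v, v} (Ind.yoneda (C := Kᵒᵖ)).op :=
    preservesColimitsOfSize_op _
  infer_instance

theorem isCosheaf_iff_isCosheaf_comp_toPro (A : Opens X ⥤ K) :
    IsCosheaf A ↔ IsCosheaf (A ⋙ toPro K) := by
  simp only [IsCosheaf, isIso_sieveMap_iff]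
  refine forall_congr' fun U => forall_congr' fun R => forall_congr' fun hR => ?_
  exact ⟨fun ⟨h⟩ => ⟨isColimitOfPreserves (toPro K) h⟩,
    fun ⟨h⟩ => ⟨isColimitOfReflects (toPro K) h⟩⟩

theorem isCoseparated_iff_isCoseparated_comp_toPro (A : Opens X ⥤ K) :
    IsCoseparated A ↔ IsCoseparated (A ⋙ toPro K) := by
  refine forall_congr' fun U => forall_congr' fun R => forall_congr' fun hR => ?_
  have h : sieveMap (A ⋙ toPro K) R =
      (preservesColimitIso (toPro K) (R.arrows.diagram ⋙ A)).inv ≫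
        (toPro K).map (sieveMap A R) := by
    refine colimit.hom_ext fun j => ?_
    refine (colimit.ι_desc _ _).trans (.symm ?_)
    refine (ι_preservesColimitIso_inv_assoc (toPro K) (R.arrows.diagram ⋙ A) j _).trans ?_
    rw [← Functor.map_comp]
    exact congrArg _ (colimit.ι_desc _ _)
  rw [h, ← (toPro K).epi_map_iff_epi]
  exact (epi_comp_iff_of_epi _ _).symm

theorem isCosheafification_sheafify (A : Opens X ⥤ Pro K) :
    IsCosheafification (C := ((Opens.grothendieckTopology X).sheafify A.leftOp).rightOp)
      (NatTrans.removeLeftOp ((Opens.grothendieckTopology X).toSheafify A.leftOp)) where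
  isCosheaf := (isCosheaf_iff_isSheaf_leftOp _).2 (isSheaf_sheafify A.leftOp)
  existsUnique_lift D hD φ := by
    have hD' := (isCosheaf_iff_isSheaf_leftOp _).1 hD
    refine ⟨NatTrans.removeLeftOp (GrothendieckTopology.sheafifyLift _ (NatTrans.leftOp φ) hD'),
      ?_, fun ψ hψ => ?_⟩
    · exact congrArg NatTrans.removeLeftOp
        (GrothendieckTopology.toSheafify_sheafifyLift _ (NatTrans.leftOp φ) hD')
    · exact congrArg NatTrans.removeLeftOp
        (GrothendieckTopology.sheafifyLift_unique _ (NatTrans.leftOp φ) hD' (NatTrans.leftOp ψ)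
          (congrArg NatTrans.leftOp hψ))

theorem IsCosheafification.exists_iso {A C C' : Opens X ⥤ Pro K} {ε : C ⟶ A} {ε' : C' ⟶ A}
    (h : IsCosheafification ε) (h' : IsCosheafification ε') : ∃ e : C ≅ C', e.hom ≫ ε' = ε := by
  obtain ⟨a, ha, -⟩ := h'.existsUnique_lift C h.isCosheaf ε
  obtain ⟨b, hb, -⟩ := h.existsUnique_lift C' h'.isCosheaf ε'
  refine ⟨⟨a, b, ?_, ?_⟩, ha⟩
  · exact (h.existsUnique_lift C h.isCosheaf ε).unique (by simp [ha, hb]) (by simp)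
  · exact (h'.existsUnique_lift C' h'.isCosheaf ε').unique (by simp [ha, hb]) (by simp)

/-- The isomorphism between the presheaves dual to isomorphic precosheaves. -/
def isoLeftOp {D : Type w} [Category.{v} D] {F G : Opens X ⥤ Dᵒᵖ} (e : F ≅ G) :
    G.leftOp ≅ F.leftOp where
  hom := NatTrans.leftOp e.hom
  inv := NatTrans.leftOp e.inv
  hom_inv_id := by rw [← NatTrans.leftOp_comp, e.inv_hom_id, NatTrans.leftOp_id]
  inv_hom_id := by rw [← NatTrans.leftOp_comp, e.hom_inv_id, NatTrans.leftOp_id]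

/-- By uniqueness of coreflections, `ε` is dual to a sheafification unit. -/
theorem IsCosheafification.isLocalIso {A C : Opens X ⥤ Pro K} {ε : C ⟶ A}
    (h : IsCosheafification ε) : IsLocalIso (NatTrans.leftOp ε) := by
  obtain ⟨e, rfl⟩ := h.exists_iso (isCosheafification_sheafify A)
  rw [NatTrans.leftOp_comp]
  exact isLocalIso_comp (isLocalIso_toSheafify A.leftOp) (isLocalIso_of_isIso (isoLeftOp e).hom)

theorem IsStrongLocalIso.nonempty_sheafify_iso {A B : Opens X ⥤ K} {f : A ⟶ B}
    (hf : IsStrongLocalIso f) :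
    Nonempty ((Opens.grothendieckTopology X).sheafify (A ⋙ toPro K).leftOp ≅
      (Opens.grothendieckTopology X).sheafify (B ⋙ toPro K).leftOp) := by
  have := isIso_sheafifyMap ((isStrongLocalIso_iff f).1 hf)
  exact ⟨(asIso ((Opens.grothendieckTopology X).sheafifyMap
    (NatTrans.leftOp (Functor.whiskerRight f (toPro K))))).symm⟩

theorem IsCosheafification.isRudimentary_of_iso {A C₀ : Opens X ⥤ K} {C : Opens X ⥤ Pro K}
    {ε : C ⟶ A ⋙ toPro K} (h : IsCosheafification ε) (hC₀ : IsCosheaf C₀)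
    (e : (Opens.grothendieckTopology X).sheafify (A ⋙ toPro K).leftOp ≅
      (Opens.grothendieckTopology X).sheafify (C₀ ⋙ toPro K).leftOp) (U : Opens X) :
    IsRudimentary (C.obj U) := by
  obtain ⟨e', -⟩ := h.exists_iso (isCosheafification_sheafify _)
  -- The dual of `C₀` is already a sheaf, hence its own sheafification.
  have hS := (isCosheaf_iff_isSheaf_leftOp _).1 ((isCosheaf_iff_isCosheaf_comp_toPro C₀).1 hC₀)
  exact ⟨C₀.obj U, ⟨(e'.app U ≪≫
    ((e ≪≫ (GrothendieckTopology.isoSheafify _ hS).symm).symm.app (op U)).op).symm⟩⟩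

theorem IsCosheafification.exists_isStrongLocalIso {A : Opens X ⥤ K} {C : Opens X ⥤ Pro K}
    {ε : C ⟶ A ⋙ toPro K} (h : IsCosheafification ε) (hC : ∀ U, IsRudimentary (C.obj U)) :
    ∃ (C₀ : Opens X ⥤ K) (f : C₀ ⟶ A), IsCosheaf C₀ ∧ IsStrongLocalIso f := by
  let e := Functor.essImage.liftFunctorCompIso C (toPro K) hC
  -- Full faithfulness of the embedding descends the counit to a map of `K`-valued precosheaves.
  obtain ⟨f, hf⟩ := ((Functor.whiskeringRight (Opens X) K (Pro K)).obj (toPro K)).map_surjective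
    (e.hom ≫ ε)
  refine ⟨_, f, ?_, ?_⟩
  · rw [isCosheaf_iff_isCosheaf_comp_toPro, isCosheaf_iff_isSheaf_leftOp]
    exact (Presheaf.isSheaf_of_iso_iff (isoLeftOp e)).1
      ((isCosheaf_iff_isSheaf_leftOp _).1 h.isCosheaf)
  · rw [isStrongLocalIso_iff]
    change Functor.whiskerRight f (toPro K) = _ at hf
    rw [hf, NatTrans.leftOp_comp]
    exact isLocalIso_comp h.isLocalIso (isLocalIso_of_isIso (isoLeftOp e).hom)

theorem IsCosheafification.isSmooth_iff {A : Opens X ⥤ K} {C : Opens X ⥤ Pro K}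
    {ε : C ⟶ A ⋙ toPro K} (h : IsCosheafification ε) :
    IsSmooth A ↔ ∀ U, IsRudimentary (C.obj U) := by
  constructor
  · rintro ⟨B, C₀, f, g, hC₀, hf, hg⟩
    exact h.isRudimentary_of_iso hC₀
      (hf.nonempty_sheafify_iso.some ≪≫ hg.nonempty_sheafify_iso.some.symm)
  · intro hC
    obtain ⟨C₀, f, hC₀, hf⟩ := h.exists_isStrongLocalIso hC
    -- The descended counit alone suffices; the other leg is an identity.
    exact ⟨A, C₀, 𝟙 A, f, hC₀, isStrongLocalIso_id A, hf⟩

theorem IsCosheafification.isSmooth'_iff {A : Opens X ⥤ K} {C : Opens X ⥤ Pro K}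
    {ε : C ⟶ A ⋙ toPro K} (h : IsCosheafification ε) :
    IsSmooth' A ↔ ∀ U, IsRudimentary (C.obj U) := by
  constructor
  · rintro ⟨B, C₀, f, g, hC₀, hf, hg⟩
    exact h.isRudimentary_of_iso hC₀
      (hf.nonempty_sheafify_iso.some.symm ≪≫ hg.nonempty_sheafify_iso.some)
  · intro hC
    obtain ⟨C₀, f, hC₀, hf⟩ := h.exists_isStrongLocalIso hC
    exact ⟨C₀, C₀, f, 𝟙 C₀, hC₀, hf, isStrongLocalIso_id C₀⟩

end ProCosheaf

theorem theorem2p6 {K : Type u} [Category.{v} K] [HasColimits K] {X : TopCat.{v}}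
    (A : Opens X ⥤ K) :
    (ProCosheaf.IsCoseparated A ↔ ProCosheaf.IsCoseparated (A ⋙ ProCosheaf.toPro K)) ∧
    (ProCosheaf.IsCosheaf A ↔ ProCosheaf.IsCosheaf (A ⋙ ProCosheaf.toPro K)) ∧
    (∃ (C : Opens X ⥤ ProCosheaf.Pro K) (ε : C ⟶ A ⋙ ProCosheaf.toPro K),
      ProCosheaf.IsCosheafification ε) ∧
    (∀ (C : Opens X ⥤ ProCosheaf.Pro K) (ε : C ⟶ A ⋙ ProCosheaf.toPro K),
      ProCosheaf.IsCosheafification ε →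
        (ProCosheaf.IsSmooth A ↔ ∀ U : Opens X, ProCosheaf.IsRudimentary (C.obj U)) ∧
        (ProCosheaf.IsSmooth' A ↔ ∀ U : Opens X, ProCosheaf.IsRudimentary (C.obj U))) :=
  ⟨ProCosheaf.isCoseparated_iff_isCoseparated_comp_toPro A,
    ProCosheaf.isCosheaf_iff_isCosheaf_comp_toPro A,
    ⟨_, _, ProCosheaf.isCosheafification_sheafify _⟩,
    fun _ _ h => ⟨h.isSmooth_iff, h.isSmooth'_iff⟩⟩
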